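/- Graphs are finite and simple; the graph with no vertices is allowed. A graph property is an isomorphism-closed class of graphs. It is additive if it is closed under disjoint unions, and induced-hereditary if it is closed under taking induced subgraphs. A property is non-trivial if it contains at least one graph with at least one vertex and does not contain all graphs. The product $\mathcal P_1\circ\cdots\circ\mathcal P_n$ is the class of graphs $G$ whose vertex set has a partition $(V_1,\dots,V_n)$ into possibly empty sets with $G[V_i]\in\mathcal P_i$ for all $i$. An additive induced-hereditary property is irreducible if it is not the product of at least two non-trivial additive induced-hereditary properties. The $*$-join $G_1*\cdots*G_n$ is the set of all graphs obtained from the disjoint union of $G_1,\dots,G_n$ by adding edges (possibly none) between vertices of different $G_i$'s, and $kG$ is the disjoint union of $k$ copies of $G$. A $\mathcal P$-decomposition of a graph $G$ with $n$ parts is a partition $(V_1,\dots,V_n)$ of $V(G)$ into non-empty sets such that $kG[V_1]*\cdots*kG[V_n]\subseteq\mathcal P$ for all integers $k\ge 1$; $dec_{\mathcal P}(G)$ is the maximum number of parts in a $\mathcal P$-decomposition of $G$ (and $0$ if $G\notin\mathcal P$). A graph $G$ is $\mathcal P$-strict if $G\in\mathcal P$ but $G*K_1\not\subseteq\mathcal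 P$, and $dec(\mathcal P)$ is the minimum of $dec_{\mathcal P}(G)$ over all $\mathcal P$-strict graphs $G$. **Theorem (Additive Induced-Hereditary Unique Factorisation Theorem).** Let $\mathcal P$ be a non-trivial additive induced-hereditary graph property. Then $\mathcal P$ has a factorisation $\mathcal P=\mathcal P_1\circ\cdots\circ\mathcal P_n$ into irreducible non-trivial additive induced-hereditary properties with $n=dec(\mathcal P)$ factors, and this factorisation is unique up to the order of the factors: if $\mathcal P=\mathcal R_1\circ\cdots\circ\mathcal R_m$ is any factorisation of $\mathcal P$ into irreducible non-trivial additive induced-hereditary properties, with any number $m$ of factors, then $m=dec(\mathcal P)$ and there is a bijection $\sigma$ from $\{1,\dots,m\}$ to $\{1,\dots,n\}$ with $\mathcal R_i=\mathcal P_{\sigma(i)}$ for all $i$. -/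

import Mathlib

/-- A graph property: an isomorphism-closed collection of finite simple graphs. Two graph properties
are equal exactly when the same finite graphs have them (`GraphProperty.ext`). -/
@[ext]
structure GraphProperty where
  /-- `P.Holds G` means that the finite graph `G` has the property `P`. -/
  Holds : ∀ {V : Type} [Finite V], SimpleGraph V → Prop
  iso_closed : ∀ {V W : Type} [Finite V] [Finite W] {G : SimpleGraph V} {H : SimpleGraph W},
    (G ≃g H) → Holds G → Holds H

namespace GraphProperty

/-- Some graph with at least one vertex has the property, and some finite graph does not have it.
(The graph without vertices is a graph here; it has every nonempty induced-hereditary property.) -/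
def IsNontrivial (P : GraphProperty) : Prop :=
  (∃ (V : Type) (_ : Finite V) (_ : Nonempty V) (G : SimpleGraph V), P.Holds G) ∧
  (∃ (V : Type) (_ : Finite V) (G : SimpleGraph V), ¬ P.Holds G)

/-- Closed under taking induced subgraphs. -/
def IsInducedHereditary (P : GraphProperty) : Prop :=
  ∀ {V W : Type} [Finite V] [Finite W] (G : SimpleGraph V) (H : SimpleGraph W),
    G.IsIndContained H → P.Holds H → P.Holds G

/-- Closed under taking disjoint unions. -/
def IsAdditive (P : GraphProperty) : Prop :=
  ∀ {V W : Type} [Finite V] [Finite W] (G : SimpleGraph V) (H : SimpleGraph W),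
    P.Holds G → P.Holds H → P.Holds (G.sum H)

/-- The product `Q 0 ∘ ⋯ ∘ Q (n - 1)`: the vertex set has a partition into `n` possibly empty sets
(the fibres of `c`) of which the `i`-th one induces a graph with property `Q i`. -/
def prod {n : ℕ} (Q : Fin n → GraphProperty) : GraphProperty where
  Holds {V} _ G := ∃ c : V → Fin n, ∀ i, (Q i).Holds (G.induce (c ⁻¹' {i}))
  iso_closed := by
    rintro V W _ _ G H e ⟨c, hc⟩
    refine ⟨c ∘ e.symm, fun i => (Q i).iso_closed ?_ (hc i)⟩
    exact
      { toEquiv := e.toEquiv.subtypeEquiv (fun a => by simp)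
        map_rel_iff' := by
          intro a b
          exact e.map_rel_iff }

/-- Not the product of at least two non-trivial additive induced-hereditary properties. -/
def IsIrreducible (P : GraphProperty) : Prop :=
  ¬ ∃ (n : ℕ) (Q : Fin n → GraphProperty), 2 ≤ n ∧
    (∀ i, (Q i).IsNontrivial ∧ (Q i).IsAdditive ∧ (Q i).IsInducedHereditary) ∧ P = prod Q

/-- `Q` is a factorisation of `P` into irreducible (non-trivial) additive induced-hereditary
factors. -/
def IsIrredFactorisation (P : GraphProperty) {n : ℕ} (Q : Fin n → GraphProperty) : Prop :=
  (∀ i, (Q i).IsNontrivial ∧ (Q i).IsAdditive ∧ (Q i).IsInducedHereditary ∧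
    (Q i).IsIrreducible) ∧ P = prod Q

/-- The disjoint union of a family of graphs. -/
def disjUnion {ι : Type} {V : ι → Type} (G : ∀ i, SimpleGraph (V i)) :
    SimpleGraph (Σ i, V i) where
  Adj x y := ∃ (i : ι) (a b : V i), x = ⟨i, a⟩ ∧ y = ⟨i, b⟩ ∧ (G i).Adj a b
  symm := ⟨by
    rintro x y ⟨i, a, b, hx, hy, h⟩
    exact ⟨i, b, a, hy, hx, h.symm⟩⟩
  loopless := ⟨by
    rintro x ⟨i, a, b, hx, hy, h⟩
    rw [hx] at hy
    cases hy
    exact h.ne rfl⟩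

/-- The join of a family of graphs: their disjoint union together with all edges between the vertex
sets of different members. -/
def join {ι : Type} {V : ι → Type} (G : ∀ i, SimpleGraph (V i)) : SimpleGraph (Σ i, V i) :=
  disjUnion G ⊔ SimpleGraph.completeMultipartiteGraph V

/-- The `*`-join of a family of graphs (each graph of it up to isomorphism): all graphs between the
disjoint union and the join. -/
def starJoin {ι : Type} {V : ι → Type} (G : ∀ i, SimpleGraph (V i)) :
    Set (SimpleGraph (Σ i, V i)) :=
  {H | disjUnion G ≤ H ∧ H ≤ join G}

/-- The `*`-join of two graphs. -/
def starJoin₂ {V W : Type} (G : SimpleGraph V) (H : SimpleGraph W) : Set (SimpleGraph (V ⊕ W)) :=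
  {F | G.sum H ≤ F ∧ F ≤ G.sum H ⊔ completeBipartiteGraph V W}

/-- The disjoint union of `k` copies of `G`. -/
def copies (k : ℕ) {V : Type} (G : SimpleGraph V) : SimpleGraph (Σ _ : Fin k, V) :=
  disjUnion fun _ : Fin k => G

/-- The fibres of `c` form a `P`-decomposition `(V₁, …, Vₙ)` of `G`: they are nonempty, and
`kG[V₁] * ⋯ * kG[Vₙ] ⊆ P` for all positive integers `k`. -/
def IsDecomposition (P : GraphProperty) {V : Type} [Finite V] (G : SimpleGraph V) {n : ℕ}
    (c : V → Fin n) : Prop :=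
  Function.Surjective c ∧
    ∀ k : ℕ, 0 < k → ∀ H ∈ starJoin (fun i : Fin n => copies k (G.induce (c ⁻¹' {i}))), P.Holds H

/-- The `P`-decomposability number of `G`: the maximum number of parts in a `P`-decomposition of
`G`. The set below is bounded by the number of vertices. If `G` does not have the property `P`, then
`G` has no `P`-decomposition with at least one part (take `k = 1`) and the value is `0`. -/
noncomputable def graphDec (P : GraphProperty) {V : Type} [Finite V] (G : SimpleGraph V) : ℕ :=
  sSup {n : ℕ | ∃ c : V → Fin n, P.IsDecomposition G c}

/-- `G` is `P`-strict: `G` has property `P`, but `G * K₁ ⊈ P`. -/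
def IsStrict (P : GraphProperty) {V : Type} [Finite V] (G : SimpleGraph V) : Prop :=
  P.Holds G ∧ ∃ H ∈ starJoin₂ G (⊥ : SimpleGraph Unit), ¬ P.Holds H

/-- The decomposability number of `P`: the minimum of the `P`-decomposability numbers of the
`P`-strict graphs. -/
noncomputable def dec (P : GraphProperty) : ℕ :=
  sInf {d : ℕ | ∃ (V : Type) (_ : Finite V) (G : SimpleGraph V), P.IsStrict G ∧ P.graphDec G = d}

end GraphProperty

namespace GraphProperty

open Function

/-! Decompositions are handled as good colourings: a colouring `c` of `G` is good if every graph
made from disjoint copies of `G`, with edges between different colours changed arbitrarily and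
vertices deleted, has property `P`. Colourings with classes in the factors of a factorisation are
good, and on a strict graph they use every colour. Choose a strict graph attaining the minimum
`P.dec`: it is tight, and so is every graph in `P` that contains it as an induced subgraph.

The engine is `IsTight.exists_isLayered_refining`. If a colouring with `P.dec` colours does not
refine `c`, the common refinement of the two has too many classes to be good, so some blowup of it
leaves `P`. Planting such bad blowups between copies of `G`, for all the finitely many non-refining
colourings in turn, forces every suitable good colouring to refine `c` on some copy.

Uniqueness: finitely many counterexamples, one for each possible map between index sets, are placed
in one universal graph. Hence a single map `f` matches the factors `Q a` with the factors `R j` for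
all graphs at once. Each `R j` is then the product of the `Q a` with `f a = j`, and irreducibility
makes `f` a bijection.

Existence: tight graphs with good colourings by all `P.dec` colours are preordered by coloured
blowup. By the forcing argument, each graph of `P` lies below a cofinal set of them. Up to
isomorphism there are countably many graphs, so one ideal meets all these sets, and its colour
classes generate the factors. These are irreducible, since splitting one would give a tight graph
too many colours. -/

theorem IsInducedHereditary.of_injective {Q : GraphProperty} (hQ : Q.IsInducedHereditary)
    {V W : Type} [Finite V] [Finite W] {G : SimpleGraph V} {H : SimpleGraph W} (f : V → W)
    (hf : Injective f) (hadj : ∀ v w, H.Adj (f v) (f w) ↔ G.Adj v w) (h : Q.Holds H) :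
    Q.Holds G :=
  hQ G H ⟨⟨⟨f, hf⟩, fun {a b} => hadj a b⟩⟩ h

/-! ### Non-trivial additive induced-hereditary properties -/

/-- The properties that may occur as factors: non-trivial, additive and induced-hereditary. -/
structure IsFactor (Q : GraphProperty) : Prop where
  nontrivial : Q.IsNontrivial
  additive : Q.IsAdditive
  hereditary : Q.IsInducedHereditary

theorem IsFactor.of_injective {Q : GraphProperty} (hQ : Q.IsFactor)
    {V W : Type} [Finite V] [Finite W] {G : SimpleGraph V} {H : SimpleGraph W} (f : V → W)
    (hf : Injective f) (hadj : ∀ v w, H.Adj (f v) (f w) ↔ G.Adj v w) (h : Q.Holds H) :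
    Q.Holds G :=
  IsInducedHereditary.of_injective hQ.hereditary f hf hadj h

theorem IsFactor.holds_of_subsingleton {Q : GraphProperty} (hQ : Q.IsFactor) {V : Type} [Finite V]
    [Subsingleton V] (G : SimpleGraph V) : Q.Holds G := by
  obtain ⟨W, _, ⟨w⟩, H, hH⟩ := hQ.nontrivial.1
  refine hQ.of_injective (fun _ => w) (fun _ _ _ => Subsingleton.elim _ _) ?_ hH
  intro a b
  simp [Subsingleton.elim a b]

/-- A graph without edges between the fibres of `κ` has an additive property as soon as all fibres
have it. -/
theorem IsFactor.holds_of_fibres {Q : GraphProperty} (hQ : Q.IsFactor) {K : Type} (N : ℕ) :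
    ∀ {W : Type} [Finite W] (H : SimpleGraph W) (κ : W → K), Nat.card W ≤ N →
      (∀ x y, H.Adj x y → κ x = κ y) → (∀ k, Q.Holds (H.induce (κ ⁻¹' {k}))) → Q.Holds H := by
  induction N with
  | zero =>
    intro W _ H κ hN _ _
    have : IsEmpty W := by
      rcases Nat.card_eq_zero.1 (Nat.le_zero.1 hN) with h | h
      · exact h
      · exact absurd h (by simpa using ‹Finite W›)
    exact hQ.holds_of_subsingleton H
  | succ N ih =>
    intro W _ H κ hN hκ hfib
    rcases isEmpty_or_nonempty W with hW | ⟨⟨w⟩⟩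
    · exact hQ.holds_of_subsingleton H
    have hcard : Nat.card {x // κ x ≠ κ w} ≤ N := by
      have : Nat.card {x // κ x ≠ κ w} < Nat.card W :=
        Finite.card_subtype_lt (x := w) (by simp)
      omega
    have h1 := ih (H.induce {x | κ x ≠ κ w}) (fun x => κ x.1) hcard (fun x y h => hκ _ _ h)
      (fun k => hQ.of_injective (fun x => ⟨x.1.1, x.2⟩)
        (fun x y h => by
          have := congrArg Subtype.val h
          exact Subtype.ext (Subtype.ext this)) (fun _ _ => Iff.rfl) (hfib k))
    classical
    refine hQ.of_injective
      (fun x => if h : κ x = κ w then Sum.inl ⟨x, h⟩ else Sum.inr ⟨x, h⟩) ?_ ?_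
      (hQ.additive _ _ (hfib (κ w)) h1)
    · refine LeftInverse.injective (g := Sum.elim (fun x => x.1) fun x => x.1) fun x => ?_
      by_cases hx : κ x = κ w <;> simp [hx]
    · intro x y
      by_cases hx : κ x = κ w <;> by_cases hy : κ y = κ w <;> simp [hx, hy]
      · exact fun h => hy ((hκ _ _ h).symm.trans hx)
      · exact fun h => hx ((hκ _ _ h).trans hy)

/-! ### Blowups and good colourings -/

/-- `H` is obtained from disjoint copies, indexed by `κ`, of the graph `G`, by changing edges
between vertices of different colours and by deleting vertices. -/
structure IsBlowup {V W K ι : Type} (G : SimpleGraph V) (c : V → ι) (H : SimpleGraph W)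
    (φ : W → V) (κ : W → K) : Prop where
  inj : ∀ x y, φ x = φ y → κ x = κ y → x = y
  adj : ∀ x y, c (φ x) = c (φ y) → (H.Adj x y ↔ κ x = κ y ∧ G.Adj (φ x) (φ y))

theorem IsBlowup.of_injective {V W ι : Type} {G : SimpleGraph V} {H : SimpleGraph W} (c : V → ι)
    (f : W → V) (hf : Injective f) (h : ∀ x y, c (f x) = c (f y) → (H.Adj x y ↔ G.Adj (f x) (f y))) :
    IsBlowup G c H f (fun _ => ()) :=
  ⟨fun _ _ h _ => hf h, fun x y hc => by simp [h x y hc]⟩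

theorem IsBlowup.trans {U V W K L ι : Type} {F : SimpleGraph U} {c : U → ι} {G : SimpleGraph V}
    {φ : V → U} {κ : V → K} {H : SimpleGraph W} {ψ : W → V} {μ : W → L}
    (h : IsBlowup F c G φ κ) (h' : IsBlowup G (c ∘ φ) H ψ μ) :
    IsBlowup F c H (φ ∘ ψ) (fun x => (μ x, κ (ψ x))) := by
  refine ⟨fun x y h1 h2 => ?_, fun x y hc => ?_⟩
  · rw [Prod.mk.injEq] at h2
    exact h'.inj _ _ (h.inj _ _ h1 h2.2) h2.1
  · rw [h'.adj x y hc, h.adj _ _ hc, Prod.mk.injEq, and_assoc]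
    rfl

/-- All graphs obtained by blowing up the coloured graph `G` have property `P`. -/
def IsGood (P : GraphProperty) {V ι : Type} (G : SimpleGraph V) (c : V → ι) : Prop :=
  ∀ ⦃W : Type⦄ [Finite W] ⦃K : Type⦄ [Finite K] ⦃H : SimpleGraph W⦄ ⦃φ : W → V⦄ ⦃κ : W → K⦄,
    IsBlowup G c H φ κ → P.Holds H

theorem IsGood.blowup {P : GraphProperty} {V W K ι : Type} [Finite K] {G : SimpleGraph V} {c : V → ι}
    {H : SimpleGraph W} {φ : W → V} {κ : W → K} (hc : P.IsGood G c) (h : IsBlowup G c H φ κ) :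
    P.IsGood H (c ∘ φ) :=
  fun _ _ _ _ _ _ _ h' => hc (h.trans h')

theorem IsGood.restrict {P : GraphProperty} {V W ι : Type} {G : SimpleGraph V} {c : V → ι}
    {H : SimpleGraph W} (hc : P.IsGood G c) (f : W → V) (hf : Injective f)
    (h : ∀ x y, H.Adj x y ↔ G.Adj (f x) (f y)) : P.IsGood H (c ∘ f) :=
  hc.blowup (IsBlowup.of_injective c f hf fun x y _ => h x y)

theorem IsGood.holds {P : GraphProperty} {V ι : Type} [Finite V] {G : SimpleGraph V} {c : V → ι}
    (hc : P.IsGood G c) : P.Holds G :=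
  hc (IsBlowup.of_injective c id injective_id fun _ _ _ => Iff.rfl)

theorem IsGood.coarsen {P : GraphProperty} {V ι ι' : Type} {G : SimpleGraph V} {c : V → ι}
    {c' : V → ι'} (hc : P.IsGood G c) (h : ∀ x y, c x = c y → c' x = c' y) : P.IsGood G c' :=
  fun _ _ _ _ _ _ _ hH => hc ⟨hH.inj, fun x y hxy => hH.adj x y (h _ _ hxy)⟩

/-- If the colours of a strict induced subgraph of `H` are not all colours of `H`, then the
colouring of `H` is not good. -/
theorem IsGood.surjective_restrict {P : GraphProperty} {V W ι : Type} [Finite V]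
    {G : SimpleGraph V} {H : SimpleGraph W} {c : W → ι} (hc : P.IsGood H c)
    (hG : P.IsStrict G) (f : V → W) (hf : Injective f) (h : ∀ x y, G.Adj x y ↔ H.Adj (f x) (f y))
    (w : W) : ∃ v, c (f v) = c w := by
  by_contra! hne
  obtain ⟨F, ⟨hF1, hF2⟩, hF⟩ := hG.2
  refine hF (hc (IsBlowup.of_injective c (Sum.elim f fun _ => w) ?_ ?_))
  · rintro (x | x) (y | y) hxy
    · exact congrArg _ (hf hxy)
    · exact absurd (congrArg c hxy) (hne x)
    · exact absurd (congrArg c hxy).symm (hne y)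
    · rfl
  · rintro (x | x) (y | y) hxy
    · simp only [Sum.elim_inl]
      rw [← h]
      refine ⟨fun h' => ?_, fun h' => hF1 (by simpa using h')⟩
      simpa using hF2 h'
    · exact absurd hxy (hne x)
    · exact absurd hxy.symm (hne y)
    · simp

theorem disjUnion_adj {ι : Type} {V : ι → Type} (G : ∀ i, SimpleGraph (V i)) (i : ι) (a b : V i) :
    (disjUnion G).Adj ⟨i, a⟩ ⟨i, b⟩ ↔ (G i).Adj a b := by
  refine ⟨?_, fun h => ⟨i, a, b, rfl, rfl, h⟩⟩
  rintro ⟨j, x, y, hx, hy, h⟩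
  cases hx
  cases hy
  exact h

theorem fst_eq_of_disjUnion_adj {ι : Type} {V : ι → Type} {G : ∀ i, SimpleGraph (V i)}
    {x y : Σ i, V i} (h : (disjUnion G).Adj x y) : x.1 = y.1 := by
  obtain ⟨i, a, b, rfl, rfl, -⟩ := h
  rfl

theorem disjUnion_copies_adj {V ι : Type} (G : SimpleGraph V) (c : V → ι) (k : ℕ)
    (x y : Σ i, Σ _ : Fin k, c ⁻¹' {i}) :
    (disjUnion fun i => copies k (G.induce (c ⁻¹' {i}))).Adj x y ↔
      x.1 = y.1 ∧ x.2.1 = y.2.1 ∧ G.Adj x.2.2 y.2.2 := by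
  constructor
  · rintro ⟨i, _, _, rfl, rfl, j, a, b, rfl, rfl, h⟩
    exact ⟨rfl, rfl, h⟩
  · obtain ⟨i, j, a⟩ := x
    obtain ⟨i', j', b⟩ := y
    rintro ⟨h1, h2, h3⟩
    dsimp only at h1 h2
    subst h1 h2
    exact ⟨i, _, _, rfl, rfl, j, a, b, rfl, rfl, h3⟩

/-- Blowups are, up to isomorphism, the induced subgraphs of members of the `*`-joins, so heredity
makes both conditions equivalent. Good colourings compose and restrict without the dependent types
of the `*`-join. -/
theorem isDecomposition_iff {P : GraphProperty} (hP : P.IsInducedHereditary) {V : Type} [Finite V]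
    (G : SimpleGraph V) {n : ℕ} (c : V → Fin n) :
    P.IsDecomposition G c ↔ Surjective c ∧ P.IsGood G c := by
  refine and_congr_right fun _ => ⟨fun h W _ K _ H φ κ hH => ?_, fun h k _ F hF => ?_⟩
  · obtain ⟨N, ⟨e⟩⟩ := Finite.exists_equiv_fin K
    let ρ : W → Σ i, Σ _ : Fin (N + 1), c ⁻¹' {i} :=
      fun w => ⟨c (φ w), (e (κ w)).castSucc, φ w, rfl⟩
    have hρ : Injective ρ := fun x y hxy => by
      have h1 : φ x = φ y :=
        congrArg (fun z : Σ i, Σ _ : Fin (N + 1), c ⁻¹' {i} => (z.2.2 : V)) hxy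
      have h2 : (e (κ x)).castSucc = (e (κ y)).castSucc :=
        congrArg (fun z : Σ i, Σ _ : Fin (N + 1), c ⁻¹' {i} => z.2.1) hxy
      exact hH.inj x y h1 (e.injective (Fin.castSucc_injective _ h2))
    -- One copy more than `K` has elements keeps the number of copies positive when `K` is empty.
    let D := disjUnion fun i => copies (N + 1) (G.induce (c ⁻¹' {i}))
    let F : SimpleGraph (Σ i, Σ _ : Fin (N + 1), c ⁻¹' {i}) :=
      { Adj := fun x y => D.Adj x y ∨ (x.1 ≠ y.1 ∧ ∃ w w', ρ w = x ∧ ρ w' = y ∧ H.Adj w w')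
        symm := ⟨by
          rintro x y (h | ⟨h, w, w', h1, h2, h3⟩)
          · exact Or.inl h.symm
          · exact Or.inr ⟨h.symm, w', w, h2, h1, h3.symm⟩⟩
        loopless := ⟨by
          rintro x (h | h)
          · exact h.ne rfl
          · exact h.1 rfl⟩ }
    refine hP.of_injective ρ hρ ?_ (h (N + 1) N.succ_pos F ⟨fun x y h => Or.inl h, ?_⟩)
    · intro x y
      change D.Adj (ρ x) (ρ y) ∨ _ ↔ _
      rw [disjUnion_copies_adj]
      by_cases hxy : c (φ x) = c (φ y)
      · rw [hH.adj x y hxy]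
        simp [ρ, hxy]
      · simp only [ρ, hxy, false_and, false_or, ne_eq, not_false_eq_true, true_and]
        constructor
        · rintro ⟨w, w', h1, h2, h3⟩
          rwa [← hρ h1, ← hρ h2]
        · exact fun h => ⟨x, y, rfl, rfl, h⟩
    · rintro x y (h | h)
      · exact Or.inl h
      · exact Or.inr h.1
  · have hcol : ∀ x : Σ i, Σ _ : Fin k, c ⁻¹' {i}, c x.2.2 = x.1 := fun x => x.2.2.2
    refine h (φ := fun x => (x.2.2 : V)) (κ := fun x => x.2.1) ⟨?_, ?_⟩
    · rintro ⟨i, j, a, ha⟩ ⟨i', j', b, hb⟩ h1 h2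
      dsimp only at h1 h2
      subst h1 h2
      cases ha
      cases hb
      rfl
    · intro x y hxy
      rw [hcol, hcol] at hxy
      have : F.Adj x y ↔ (disjUnion fun i => copies k (G.induce (c ⁻¹' {i}))).Adj x y := by
        refine ⟨fun h' => ?_, fun h' => hF.1 h'⟩
        rcases hF.2 h' with h'' | h''
        · exact h''
        · exact absurd hxy h''
      rw [this, disjUnion_copies_adj]
      simp [hxy]

/-! ### Colourings with classes in prescribed properties -/

/-- The fibres of the colouring `c` have the properties prescribed by `Q`. -/
def HasFibres {ι V : Type} [Finite V] (Q : ι → GraphProperty) (G : SimpleGraph V) (c : V → ι) :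
    Prop :=
  ∀ i, (Q i).Holds (G.induce (c ⁻¹' {i}))

/-- All products of graphs with the properties `Q` have property `P`. -/
def ProdLE {ι : Type} (Q : ι → GraphProperty) (P : GraphProperty) : Prop :=
  ∀ ⦃V : Type⦄ [Finite V] ⦃G : SimpleGraph V⦄ ⦃c : V → ι⦄, HasFibres Q G c → P.Holds G

theorem prodLE_prod {n : ℕ} (Q : Fin n → GraphProperty) : ProdLE Q (prod Q) :=
  fun _ _ _ c h => ⟨c, h⟩

theorem HasFibres.restrict {ι V W : Type} [Finite V] [Finite W] {Q : ι → GraphProperty}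
    (hQ : ∀ i, (Q i).IsFactor) {G : SimpleGraph V} {c : V → ι} (h : HasFibres Q G c)
    {H : SimpleGraph W} (f : W → V) (hf : Injective f)
    (hadj : ∀ x y, H.Adj x y ↔ G.Adj (f x) (f y)) : HasFibres Q H (c ∘ f) :=
  fun i => (hQ i).of_injective (fun x => ⟨f x, x.2⟩)
    (fun _ _ hxy => Subtype.ext (hf (congrArg Subtype.val hxy)))
    (fun x y => (hadj x.1 y.1).symm) (h i)

/-- Within one colour a blowup is a disjoint union of induced subgraphs of the old class, so it
stays in the same factor. Edges between colours are irrelevant to a product. -/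
theorem HasFibres.isGood {ι V : Type} [Finite V] {P : GraphProperty} {Q : ι → GraphProperty}
    (hQ : ∀ i, (Q i).IsFactor) (hP : ProdLE Q P) {G : SimpleGraph V} {c : V → ι}
    (h : HasFibres Q G c) : P.IsGood G c := by
  intro W _ K _ H φ κ hH
  refine hP (c := c ∘ φ) fun i => (hQ i).holds_of_fibres _ _ (fun x => κ x.1) le_rfl ?_ fun k => ?_
  · intro x y hxy
    exact ((hH.adj x.1 y.1 (x.2.trans y.2.symm)).1 hxy).1
  · refine (hQ i).of_injective (fun x => ⟨φ x.1.1, x.1.2⟩) ?_ ?_ (h i)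
    · intro x y hxy
      exact Subtype.ext (Subtype.ext
        (hH.inj _ _ (congrArg Subtype.val hxy) (x.2.trans y.2.symm)))
    · intro x y
      have h1 := hH.adj x.1.1 y.1.1 (x.1.2.trans y.1.2.symm)
      have h2 : κ x.1.1 = κ y.1.1 := x.2.trans y.2.symm
      simp only [SimpleGraph.comap_adj, Embedding.subtype_apply, h1, h2, true_and]

theorem HasFibres.surjective {ι V : Type} [Finite V] {P : GraphProperty} {Q : ι → GraphProperty}
    (hQ : ∀ i, (Q i).IsFactor) (hP : ProdLE Q P) {G : SimpleGraph V} {c : V → ι}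
    (h : HasFibres Q G c) (hG : P.IsStrict G) : Surjective c := by
  intro i
  by_contra! hi
  obtain ⟨F, ⟨hF1, hF2⟩, hF⟩ := hG.2
  -- The added vertex receives the unused colour and is alone in its class, so the extension would
  -- still be in `P`.
  refine hF (hP (c := Sum.elim c fun _ => i) fun j => ?_)
  by_cases hj : j = i
  · subst hj
    have : Subsingleton ↥((Sum.elim c fun _ : Unit => j) ⁻¹' {j}) := by
      refine ⟨?_⟩
      rintro ⟨x | x, hx⟩ ⟨y | y, hy⟩
      · exact absurd hx (hi x)
      · exact absurd hx (hi x)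
      · exact absurd hy (hi y)
      · rfl
    exact (hQ j).holds_of_subsingleton _
  · have hl : ∀ x : ↥((Sum.elim c fun _ : Unit => i) ⁻¹' {j}), ∃ v, c v = j ∧ x.1 = Sum.inl v := by
      rintro ⟨x | x, hx⟩
      · exact ⟨x, hx, rfl⟩
      · exact absurd hx.symm hj
    choose f hf1 hf2 using hl
    refine (hQ j).of_injective (fun x => ⟨f x, hf1 x⟩) ?_ ?_ (h j)
    · intro x y hxy
      exact Subtype.ext ((hf2 x).trans ((congrArg Sum.inl (congrArg Subtype.val hxy)).trans
        (hf2 y).symm))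
    · intro x y
      simp only [SimpleGraph.comap_adj, Embedding.subtype_apply, hf2 x, hf2 y]
      refine ⟨fun h' => hF1 (by simpa using h'), fun h' => ?_⟩
      simpa using hF2 h'

/-! ### Strict and tight graphs, and the number `P.dec` -/

theorem IsStrict.mono {P : GraphProperty} (hP : P.IsInducedHereditary) {V W : Type} [Finite V]
    [Finite W] {G : SimpleGraph V} {H : SimpleGraph W} (hG : P.IsStrict G) (hH : P.Holds H)
    (f : V → W) (hf : Injective f) (h : ∀ x y, G.Adj x y ↔ H.Adj (f x) (f y)) :
    P.IsStrict H := by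
  obtain ⟨F, ⟨hF1, hF2⟩, hF⟩ := hG.2
  let e : V ⊕ Unit ↪ W ⊕ Unit := ⟨Sum.map f id, hf.sumMap injective_id⟩
  have hFG : ∀ x y, F.Adj (Sum.inl x) (Sum.inl y) ↔ G.Adj x y := fun x y =>
    ⟨fun h' => by simpa using hF2 h', fun h' => hF1 (by simpa using h')⟩
  refine ⟨hH, H.sum ⊥ ⊔ F.map e, ⟨le_sup_left, sup_le le_sup_left ?_⟩, fun hF' => hF ?_⟩
  · rintro _ _ ⟨-, x, y, hxy, rfl, rfl⟩
    rcases x with x | x <;> rcases y with y | y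
    · have := (h x y).1 ((hFG x y).1 hxy)
      simpa [e] using this
    · simp [e]
    · simp [e]
    · exact absurd hxy (F.loopless.irrefl _)
  · refine hP.of_injective e e.injective ?_ hF'
    intro x y
    rw [SimpleGraph.sup_adj, SimpleGraph.map_adj_apply]
    refine or_iff_right_of_imp ?_
    rcases x with x | x <;> rcases y with y | y <;> intro h'
    · exact (hFG x y).2 ((h x y).2 (by simpa [e] using h'))
    all_goals simp [e] at h'

/-- If no graph were strict, adding vertices one at a time would never leave `P`, and `P` would
contain all graphs. So `P.dec` is the minimum of a nonempty set. -/
theorem IsFactor.exists_isStrict {P : GraphProperty} (hP : P.IsFactor) :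
    ∃ (V : Type) (_ : Finite V) (G : SimpleGraph V), P.IsStrict G := by
  by_contra! hne
  have key : ∀ (N : ℕ) (V : Type) [Finite V] (F : SimpleGraph V), Nat.card V ≤ N → P.Holds F := by
    intro N
    induction N with
    | zero =>
      intro V _ F hN
      have : IsEmpty V := by
        rcases Nat.card_eq_zero.1 (Nat.le_zero.1 hN) with h | h
        · exact h
        · exact absurd h (by simpa using ‹Finite V›)
      exact hP.holds_of_subsingleton F
    | succ N ih =>
      intro V _ F hN
      rcases isEmpty_or_nonempty V with hV | ⟨⟨v⟩⟩
      · exact hP.holds_of_subsingleton F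
      have hcard : Nat.card {x // x ≠ v} ≤ N := by
        have : Nat.card {x // x ≠ v} < Nat.card V := Finite.card_subtype_lt (x := v) (by simp)
        omega
      have h1 := ih {x // x ≠ v} (F.comap Subtype.val) hcard
      have h2 : P.Holds (F.comap (Sum.elim Subtype.val fun _ : Unit => v) :
          SimpleGraph ({x // x ≠ v} ⊕ Unit)) := by
        by_contra hF
        refine hne _ inferInstance _ ⟨h1, _, ⟨?_, ?_⟩, hF⟩
        · rintro (x | x) (y | y) hxy <;> simp_all
        · rintro (x | x) (y | y) hxy <;> simp_all
      classical
      refine hP.of_injective (fun x => if h : x = v then Sum.inr () else Sum.inl ⟨x, h⟩) ?_ ?_ h2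
      · intro x y hxy
        by_cases hx : x = v <;> by_cases hy : y = v <;> simp_all
      · intro x y
        by_cases hx : x = v <;> by_cases hy : y = v <;> simp_all
  obtain ⟨V, _, G, hG⟩ := hP.nontrivial.2
  exact hG (key _ V G le_rfl)

/-- A strict graph none of whose good colourings has more than `n` colours. -/
structure IsTight (P : GraphProperty) (n : ℕ) {V : Type} [Finite V] (G : SimpleGraph V) : Prop where
  strict : P.IsStrict G
  le : ∀ (N : ℕ) (c : V → Fin N), Surjective c → P.IsGood G c → N ≤ n

theorem IsTight.card_range_le {P : GraphProperty} {n : ℕ} {V ι : Type} [Finite V]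
    {G : SimpleGraph V} (hG : P.IsTight n G) {c : V → ι} (hc : P.IsGood G c) :
    Nat.card (Set.range c) ≤ n := by
  have e := Finite.equivFin (Set.range c)
  refine hG.le _ (e ∘ Set.rangeFactorization c)
    (e.surjective.comp Set.rangeFactorization_surjective) (hc.coarsen fun x y hxy => ?_)
  exact congrArg e (Subtype.ext hxy)

theorem IsTight.card_le {P : GraphProperty} {n : ℕ} {V ι : Type} [Finite V]
    {G : SimpleGraph V} (hG : P.IsTight n G) {c : V → ι} (hc : P.IsGood G c) (hs : Surjective c) :
    Nat.card ι ≤ n := by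
  have := hG.card_range_le hc
  rwa [hs.range_eq, Nat.card_univ] at this

/-- A good colouring of the larger graph restricts to a good colouring of the strict subgraph
without losing a colour, so its number of colours is bounded there. -/
theorem IsTight.mono {P : GraphProperty} (hP : P.IsInducedHereditary) {n : ℕ} {V W : Type}
    [Finite V] [Finite W] {G : SimpleGraph V} {H : SimpleGraph W} (hG : P.IsTight n G)
    (hH : P.Holds H) (f : V → W) (hf : Injective f)
    (h : ∀ x y, G.Adj x y ↔ H.Adj (f x) (f y)) : P.IsTight n H := by
  refine ⟨hG.strict.mono hP hH f hf h, fun N c hs hc => ?_⟩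
  refine hG.le N (c ∘ f) (fun i => ?_) (hc.restrict f hf h)
  obtain ⟨w, rfl⟩ := hs i
  exact hc.surjective_restrict hG.strict f hf h w

theorem IsFactor.isGood_const {P : GraphProperty} (hP : P.IsFactor) {V ι : Type} [Finite V]
    {G : SimpleGraph V} (hG : P.Holds G) (i : ι) : P.IsGood G fun _ => i := by
  have h : HasFibres (fun _ : Unit => P) G fun _ => () := fun _ =>
    hP.of_injective Subtype.val Subtype.val_injective (fun _ _ => Iff.rfl) hG
  have hle : ProdLE (fun _ : Unit => P) P := fun W _ H c hc =>
    hP.of_injective (fun x => ⟨x, rfl⟩) (fun _ _ h => congrArg Subtype.val h) (fun _ _ => Iff.rfl)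
      (hc ())
  exact (h.isGood (fun _ => hP) hle).coarsen fun _ _ _ => rfl

theorem IsStrict.nonempty {P : GraphProperty} (hP : P.IsFactor) {V : Type} [Finite V]
    {G : SimpleGraph V} (hG : P.IsStrict G) : Nonempty V := by
  by_contra hV
  rw [not_nonempty_iff] at hV
  obtain ⟨F, -, hF⟩ := hG.2
  have : Subsingleton (V ⊕ Unit) := (Equiv.emptySum V Unit).subsingleton
  exact hF (hP.holds_of_subsingleton F)

theorem bddAbove_isDecomposition (P : GraphProperty) {V : Type} [Finite V] (G : SimpleGraph V) :
    BddAbove {n : ℕ | ∃ c : V → Fin n, P.IsDecomposition G c} := by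
  refine ⟨Nat.card V, ?_⟩
  rintro n ⟨c, hc⟩
  simpa using Nat.card_le_card_of_surjective c hc.1

theorem IsStrict.one_le_graphDec {P : GraphProperty} (hP : P.IsFactor) {V : Type} [Finite V]
    {G : SimpleGraph V} (hG : P.IsStrict G) : 1 ≤ P.graphDec G := by
  obtain ⟨v⟩ := hG.nonempty hP
  refine le_csSup (bddAbove_isDecomposition P G) ⟨fun _ => 0, ?_⟩
  exact (isDecomposition_iff hP.hereditary G _).2
    ⟨fun i => ⟨v, Subsingleton.elim _ _⟩, hP.isGood_const hG.1 _⟩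

theorem IsFactor.dec_mem {P : GraphProperty} (hP : P.IsFactor) :
    ∃ (V : Type) (_ : Finite V) (G : SimpleGraph V), P.IsStrict G ∧ P.graphDec G = P.dec := by
  obtain ⟨V, _, G, hG⟩ := hP.exists_isStrict
  exact Nat.sInf_mem (s := {d : ℕ | ∃ (V : Type) (_ : Finite V) (G : SimpleGraph V),
    P.IsStrict G ∧ P.graphDec G = d}) ⟨_, V, _, G, hG, rfl⟩

theorem IsFactor.one_le_dec {P : GraphProperty} (hP : P.IsFactor) : 1 ≤ P.dec := by
  obtain ⟨V, _, G, hG, h⟩ := hP.dec_mem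
  exact h ▸ hG.one_le_graphDec hP

theorem IsFactor.exists_isTight {P : GraphProperty} (hP : P.IsFactor) :
    ∃ (V : Type) (_ : Finite V) (G : SimpleGraph V), P.IsTight P.dec G := by
  obtain ⟨V, _, G, hG, h⟩ := hP.dec_mem
  refine ⟨V, _, G, hG, fun N c hs hc => ?_⟩
  rw [← h]
  exact le_csSup (bddAbove_isDecomposition P G)
    ⟨c, (isDecomposition_iff hP.hereditary G _).2 ⟨hs, hc⟩⟩

theorem IsStrict.exists_isGood {P : GraphProperty} (hP : P.IsFactor) {V : Type} [Finite V]
    {G : SimpleGraph V} (hG : P.IsStrict G) :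
    ∃ c : V → Fin P.dec, Surjective c ∧ P.IsGood G c := by
  have hmem : P.graphDec G ∈ {n : ℕ | ∃ c : V → Fin n, P.IsDecomposition G c} := by
    -- The supremum is attained: for an empty set it would be the default value `0`, but a strict
    -- graph has the decomposition with one part.
    refine Nat.sSup_mem ?_ (bddAbove_isDecomposition P G)
    by_contra hne
    rw [Set.not_nonempty_iff_eq_empty] at hne
    have := hG.one_le_graphDec hP
    rw [graphDec, hne] at this
    simp at this
  obtain ⟨c, hc⟩ := hmem
  obtain ⟨hs, hc⟩ := (isDecomposition_iff hP.hereditary G _).1 hc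
  have hle : P.dec ≤ P.graphDec G := Nat.sInf_le ⟨V, _, G, hG, rfl⟩
  have hpos := hP.one_le_dec
  -- Surplus parts are merged into the last one; merging preserves goodness.
  let g : Fin (P.graphDec G) → Fin P.dec := fun i => ⟨min i (P.dec - 1), by omega⟩
  have hg : Surjective g := fun j => ⟨⟨j, by omega⟩, Fin.ext (by
    have := j.2
    simp only [g]
    omega)⟩
  exact ⟨g ∘ c, hg.comp hs, hc.coarsen fun x y h => congrArg g h⟩

/-! ### Layered blowups that force colourings to refine -/

/-- `H` is obtained from disjoint copies of `G` by adding edges between vertices of different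
copies and different colours. -/
structure IsLayered {V K ι : Type} (G : SimpleGraph V) (c : V → ι) (H : SimpleGraph (V × K)) :
    Prop where
  same : ∀ v w k, H.Adj (v, k) (w, k) ↔ G.Adj v w
  diff : ∀ v w k l, k ≠ l → c v = c w → ¬ H.Adj (v, k) (w, l)

theorem IsLayered.isBlowup {V K ι : Type} {G : SimpleGraph V} {c : V → ι} {H : SimpleGraph (V × K)}
    (h : IsLayered G c H) : IsBlowup G c H Prod.fst Prod.snd := by
  refine ⟨fun x y h1 h2 => Prod.ext h1 h2, ?_⟩
  rintro ⟨v, k⟩ ⟨w, l⟩ hc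
  by_cases hkl : k = l
  · subst hkl
    simp [h.same]
  · simp [hkl, h.diff v w k l hkl hc]

theorem isLayered_unit {V ι : Type} (G : SimpleGraph V) (c : V → ι) :
    IsLayered G c (G.comap Prod.fst : SimpleGraph (V × Unit)) :=
  ⟨fun _ _ _ => Iff.rfl, fun _ _ _ _ h => absurd rfl h⟩

/-- The colouring by the pairs `(c v, χ v)` has too many colours to be good. A bad blowup of it is
embedded across the layers; if every layer were coloured by `χ`, it would be a blowup for the good
colouring `C`. -/
theorem IsTight.exists_isLayered_ne {P : GraphProperty} {n : ℕ} {V ι : Type} [Finite V] [Finite ι]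
    {G : SimpleGraph V} (hG : P.IsTight n G) (c : V → ι) (χ : V → Fin n)
    (hχ : ∃ v w, χ v = χ w ∧ c v ≠ c w) :
    ∃ (K : Type) (_ : Finite K) (H : SimpleGraph (V × K)), IsLayered G c H ∧
      ∀ C : V × K → Fin n, P.IsGood H C → (∀ k, Surjective fun v => C (v, k)) →
        ∃ k, (fun v => C (v, k)) ≠ χ := by
  by_cases hs : Surjective χ
  swap
  · refine ⟨Unit, inferInstance, _, isLayered_unit G c, fun C _ hC => ⟨(), ?_⟩⟩
    rintro rfl
    exact hs (hC ())
  have hbad : ¬ P.IsGood G fun v => (c v, χ v) := by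
    intro hgood
    have hle := hG.card_range_le hgood
    obtain ⟨v, w, hvw, hne⟩ := hχ
    let p : Set.range (fun v => (c v, χ v)) → Fin n := fun x => x.1.2
    have hp : Surjective p := fun j => by
      obtain ⟨v, rfl⟩ := hs j
      exact ⟨⟨_, v, rfl⟩, rfl⟩
    -- At most `n` pairs map onto `n` colours, so `χ` would determine `c`, against the choice of `v`
    -- and `w`.
    have hbij : Bijective p :=
      (Nat.bijective_iff_surjective_and_card p).2 ⟨hp, le_antisymm (by simpa using hle)
        (Nat.card_le_card_of_surjective p hp)⟩
    have := @hbij.1 ⟨_, v, rfl⟩ ⟨_, w, rfl⟩ hvw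
    exact hne (congrArg (fun x => x.1.1) this)
  simp only [IsGood, not_forall] at hbad
  obtain ⟨W, _, K, _, F, φ, κ, hF, hFP⟩ := hbad
  -- Recording the `c`-colour in the layer puts vertices of different `c`-colours into different
  -- layers, where edges between them may be chosen as in `F`.
  let τ : W → ι × Fin n × K := fun w => (c (φ w), χ (φ w), κ w)
  have hτ : ∀ {x y}, φ x = φ y → τ x = τ y → x = y := fun h1 h2 =>
    hF.inj _ _ h1 (congrArg (fun t => t.2.2) h2)
  let H : SimpleGraph (V × (ι × Fin n × K)) :=
    { Adj := fun x y => (x.2 = y.2 ∧ G.Adj x.1 y.1) ∨ (x.2 ≠ y.2 ∧ c x.1 ≠ c y.1 ∧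
        ∃ w w', (φ w, τ w) = x ∧ (φ w', τ w') = y ∧ F.Adj w w')
      symm := ⟨by
        rintro x y (⟨h1, h2⟩ | ⟨h1, h2, w, w', h3, h4, h5⟩)
        · exact Or.inl ⟨h1.symm, h2.symm⟩
        · exact Or.inr ⟨h1.symm, h2.symm, w', w, h4, h3, h5.symm⟩⟩
      loopless := ⟨by
        rintro x (h | h)
        · exact h.2.ne rfl
        · exact h.1 rfl⟩ }
  refine ⟨_, inferInstance, H, ⟨fun v w k => ?_, fun v w k l hkl hc => ?_⟩, fun C hC _ => ?_⟩
  · simp [H]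
  · simp [H, hkl, hc]
  by_contra! hCχ
  have hCχ' : ∀ v k, C (v, k) = χ v := fun v k => congrFun (hCχ k) v
  refine hFP (hC (IsBlowup.of_injective C (fun w => (φ w, τ w)) ?_ ?_))
  · intro x y hxy
    rw [Prod.mk.injEq] at hxy
    exact hτ hxy.1 hxy.2
  · intro x y hxy
    rw [hCχ', hCχ'] at hxy
    by_cases hc : c (φ x) = c (φ y)
    · rw [hF.adj x y (Prod.ext hc hxy)]
      simp [H, τ, hc, hxy]
    · have hne : τ x ≠ τ y := fun h => hc (congrArg Prod.fst h)
      simp only [H, hne, false_and, false_or, ne_eq, not_false_eq_true, hc, true_and,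
        Prod.mk.injEq]
      refine ⟨fun h => ⟨x, y, ⟨rfl, rfl⟩, ⟨rfl, rfl⟩, h⟩, ?_⟩
      rintro ⟨w, w', ⟨h1, h2⟩, ⟨h3, h4⟩, h⟩
      rwa [hτ h1 h2, hτ h3 h4] at h

theorem IsTight.exists_isLayered_notMem {P : GraphProperty} {n : ℕ} {V ι : Type} [Finite V]
    [Finite ι] {G : SimpleGraph V} (hG : P.IsTight n G) (c : V → ι) (S : Finset (V → Fin n))
    (hS : ∀ χ ∈ S, ∃ v w, χ v = χ w ∧ c v ≠ c w) :
    ∃ (K : Type) (_ : Finite K) (H : SimpleGraph (V × K)), IsLayered G c H ∧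
      ∀ C : V × K → Fin n, P.IsGood H C → (∀ k, Surjective fun v => C (v, k)) →
        ∃ k, (fun v => C (v, k)) ∉ S := by
  classical
  induction S using Finset.induction_on with
  | empty => exact ⟨Unit, inferInstance, _, isLayered_unit G c, fun C _ _ => ⟨(), by simp⟩⟩
  | insert χ S _ ih =>
    obtain ⟨K, _, H, hH, hHS⟩ := ih fun χ' h => hS χ' (Finset.mem_insert_of_mem h)
    obtain ⟨L, _, F, hF, hFχ⟩ := hG.exists_isLayered_ne c χ (hS χ (Finset.mem_insert_self _ _))
    -- Each layer of `F` is replaced by a whole copy of `H`, and the edges between two copies depend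
    -- only on the edges of `F`. Choosing one layer from each copy thus gives an induced `F`.
    let E : SimpleGraph (V × (L × K)) :=
      { Adj := fun x y => (x.2.1 = y.2.1 ∧ H.Adj (x.1, x.2.2) (y.1, y.2.2)) ∨
          (x.2.1 ≠ y.2.1 ∧ F.Adj (x.1, x.2.1) (y.1, y.2.1))
        symm := ⟨by
          rintro x y (⟨h1, h2⟩ | ⟨h1, h2⟩)
          · exact Or.inl ⟨h1.symm, h2.symm⟩
          · exact Or.inr ⟨h1.symm, h2.symm⟩⟩
        loopless := ⟨by
          rintro x (h | h)
          · exact h.2.ne rfl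
          · exact h.1 rfl⟩ }
    refine ⟨L × K, inferInstance, E, ⟨?_, ?_⟩, fun C hC hCs => ?_⟩
    · rintro v w ⟨a, b⟩
      simp [E, hH.same]
    · rintro v w ⟨a, b⟩ ⟨a', b'⟩ hne hc
      by_cases ha : a = a'
      · subst ha
        have hb : b ≠ b' := fun h => hne (by rw [h])
        simp [E, hH.diff v w b b' hb hc]
      · simp [E, ha, hF.diff v w a a' ha hc]
    by_contra! hall
    -- By induction each copy of `H` has a layer coloured outside `S`, hence by `χ`; these layers
    -- together form the `F` that excludes this.
    have hrow : ∀ a : L, ∃ b : K, (fun v => C (v, (a, b))) = χ := by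
      intro a
      obtain ⟨b, hb⟩ := hHS (C ∘ fun x => (x.1, (a, x.2)))
        (hC.restrict _ (fun x y h => by simpa [Prod.ext_iff] using h) (fun x y => by simp [E]))
        (fun k => hCs (a, k))
      exact ⟨b, (Finset.mem_insert.1 (hall (a, b))).resolve_right hb⟩
    choose b hb using hrow
    obtain ⟨a, ha⟩ := hFχ (C ∘ fun x => (x.1, (x.2, b x.2)))
      (hC.restrict _ (fun x y h => by
        simp only [Prod.mk.injEq] at h
        exact Prod.ext h.1 h.2.1) (by
          rintro ⟨v, k⟩ ⟨w, l⟩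
          by_cases hkl : k = l
          · subst hkl
            simp [E, hH.same, hF.same]
          · simp [E, hkl]))
      (fun k => hCs (k, b k))
    exact ha (hb a)

/-- A tight coloured graph has a layered blowup such that every good colouring of the blowup
refines the given colouring on one of the layers. -/
theorem IsTight.exists_isLayered_refining {P : GraphProperty} {n : ℕ} {V ι : Type} [Finite V]
    [Finite ι] {G : SimpleGraph V} (hG : P.IsTight n G) (c : V → ι) :
    ∃ (K : Type) (_ : Finite K) (H : SimpleGraph (V × K)), IsLayered G c H ∧
      ∀ C : V × K → Fin n, P.IsGood H C → (∀ k, Surjective fun v => C (v, k)) →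
        ∃ k, ∀ v w, C (v, k) = C (w, k) → c v = c w := by
  obtain ⟨K, hK, H, hH, h⟩ := hG.exists_isLayered_notMem c
    (Set.toFinite {χ | ∃ v w, χ v = χ w ∧ c v ≠ c w}).toFinset (by simp)
  refine ⟨K, hK, H, hH, fun C hC hs => ?_⟩
  obtain ⟨k, hk⟩ := h C hC hs
  refine ⟨k, fun v w hvw => ?_⟩
  by_contra hne
  exact hk (by simpa using ⟨v, w, hvw, hne⟩)

/-! ### Uniqueness of the factorisation -/

theorem HasFibres.disjUnion {ι Ω : Type} [Finite Ω] {V : Ω → Type} [∀ ω, Finite (V ω)]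
    {Q : ι → GraphProperty} (hQ : ∀ i, (Q i).IsFactor) {G : ∀ ω, SimpleGraph (V ω)}
    {c : ∀ ω, V ω → ι} (h : ∀ ω, HasFibres Q (G ω) (c ω)) :
    HasFibres Q (GraphProperty.disjUnion G) fun x => c x.1 x.2 := by
  intro i
  refine (hQ i).holds_of_fibres _ _ (fun x => x.1.1) le_rfl
    (fun x y hxy => fst_eq_of_disjUnion_adj hxy) fun ω => ?_
  have hx : ∀ x : ↥((fun x : ↥((fun x : Σ ω, V ω => c x.1 x.2) ⁻¹' {i}) => x.1.1) ⁻¹' {ω}),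
      ∃ v : V ω, c ω v = i ∧ x.1.1 = ⟨ω, v⟩ := by
    rintro ⟨⟨⟨ω', v⟩, h1⟩, h2⟩
    cases h2
    exact ⟨v, h1, rfl⟩
  choose f hf1 hf2 using hx
  refine (hQ i).of_injective (fun x => ⟨f x, hf1 x⟩) (fun x y hxy => ?_) (fun x y => ?_) (h ω i)
  · refine Subtype.ext (Subtype.ext ?_)
    rw [hf2 x, hf2 y, Subtype.mk.inj hxy]
  · simp only [SimpleGraph.comap_adj, Embedding.subtype_apply, hf2 x, hf2 y, disjUnion_adj]

theorem hasFibres_comp_iff {ι ι' V : Type} [Finite V] {Q : ι → GraphProperty}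
    (hQ : ∀ i, (Q i).IsFactor) {G : SimpleGraph V} {c : V → ι'} {g : ι' → ι} (hg : Injective g) :
    HasFibres Q G (g ∘ c) ↔ HasFibres (Q ∘ g) G c := by
  constructor
  · intro h i
    exact (hQ (g i)).of_injective (fun x => ⟨x.1, congrArg g x.2⟩)
      (fun x y hxy => by
        have := congrArg Subtype.val hxy
        exact Subtype.ext this) (fun _ _ => Iff.rfl) (h (g i))
  · intro h i
    by_cases hi : ∃ j, g j = i
    · obtain ⟨j, rfl⟩ := hi
      exact (hQ (g j)).of_injective (fun x => ⟨x.1, hg x.2⟩)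
        (fun x y hxy => by
        have := congrArg Subtype.val hxy
        exact Subtype.ext this) (fun _ _ => Iff.rfl) (h j)
    · have : IsEmpty ↥(g ∘ c ⁻¹' {i}) := ⟨fun x => hi ⟨_, x.2⟩⟩
      exact (hQ i).holds_of_subsingleton _

theorem hasFibres_const_iff {ι V : Type} [Finite V] {Q : ι → GraphProperty}
    (hQ : ∀ i, (Q i).IsFactor) {G : SimpleGraph V} {i : ι} :
    HasFibres Q G (fun _ => i) ↔ (Q i).Holds G := by
  constructor
  · intro h
    exact (hQ i).of_injective (fun x => ⟨x, rfl⟩) (fun _ _ hxy => congrArg Subtype.val hxy)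
      (fun _ _ => Iff.rfl) (h i)
  · intro h j
    by_cases hj : i = j
    · subst hj
      exact (hQ i).of_injective Subtype.val Subtype.val_injective (fun _ _ => Iff.rfl) h
    · have : IsEmpty ↥((fun _ : V => i) ⁻¹' {j}) := ⟨fun x => hj x.2⟩
      exact (hQ j).holds_of_subsingleton _

/-- For finitely many coloured graphs with fibres in `S` there is a graph with property `P` such
that, up to a map between the sets of colours, they all appear in every colouring of it with fibres
in `Q`. -/
theorem exists_universal {P : GraphProperty} (hP : P.IsFactor) {m : ℕ}
    {S : Fin m → GraphProperty} (hS : ∀ i, (S i).IsFactor) (hSP : P = prod S)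
    {Q : Fin P.dec → GraphProperty} (hQ : ∀ i, (Q i).IsFactor) (hQP : P = prod Q)
    {Ω : Type} [Finite Ω] {V : Ω → Type} [∀ ω, Finite (V ω)] (G : ∀ ω, SimpleGraph (V ω))
    (d : ∀ ω, V ω → Fin m) (hd : ∀ ω, HasFibres S (G ω) (d ω)) :
    ∃ (W : Type) (_ : Finite W) (H : SimpleGraph W), P.Holds H ∧
      ∀ C : W → Fin P.dec, HasFibres Q H C → ∃ f : Fin P.dec → Fin m, Surjective f ∧
        ∀ ω, ∃ e : G ω ↪g H, ∀ v, d ω v = f (C (e v)) := by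
  have hleS : ProdLE S P := hSP ▸ prodLE_prod S
  have hleQ : ProdLE Q P := fun V _ G c h => by
    rw [hQP]
    exact ⟨c, h⟩
  obtain ⟨V₀, _, G₀, hG₀⟩ := hP.exists_isTight
  obtain ⟨d₀, hd₀⟩ : ∃ d₀ : V₀ → Fin m, HasFibres S G₀ d₀ := by
    have := hG₀.strict.1
    rw [hSP] at this
    exact this
  -- The index `none` adds a tight graph to the family, so that the disjoint union is tight.
  let V' : Option Ω → Type := fun o => o.elim V₀ V
  have hV' : ∀ o, Finite (V' o) := by
    rintro (_ | ω)
    · exact ‹Finite V₀›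
    · exact inferInstanceAs (Finite (V ω))
  let G' : ∀ o, SimpleGraph (V' o) := fun o => match o with
    | none => G₀
    | some ω => G ω
  let d' : ∀ o, V' o → Fin m := fun o => match o with
    | none => d₀
    | some ω => d ω
  have hd' : ∀ o, HasFibres S (G' o) (d' o) := by
    rintro (_ | ω)
    · exact hd₀
    · exact hd ω
  have hU := HasFibres.disjUnion hS hd'
  have hUgood : P.IsGood _ _ := hU.isGood hS hleS
  have hUtight : P.IsTight P.dec (disjUnion G') :=
    hG₀.mono hP.hereditary hUgood.holds (fun v => ⟨none, v⟩)
      (sigma_mk_injective (β := V') (i := none))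
      fun x y => (disjUnion_adj G' none x y).symm
  obtain ⟨K, _, H, hH, hHC⟩ := hUtight.exists_isLayered_refining fun x => d' x.1 x.2
  refine ⟨_, inferInstance, H, hUgood hH.isBlowup, fun C hC => ?_⟩
  have hsurj : ∀ k, Surjective fun v => C (v, k) := fun k =>
    (hC.restrict (H := disjUnion G') hQ (fun v => (v, k)) (fun _ _ h => congrArg Prod.fst h)
      fun x y => (hH.same x y k).symm).surjective hQ hleQ hUtight.strict
  obtain ⟨k, hk⟩ := hHC C (hC.isGood hQ hleQ) hsurj
  -- On layer `k` the colouring `C` refines `d'`, so the `d'`-colour is a function of the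
  -- `C`-colour.
  let f : Fin P.dec → Fin m := fun i => d' (surjInv (hsurj k) i).1 (surjInv (hsurj k) i).2
  have hf : ∀ x, d' x.1 x.2 = f (C (x, k)) := fun x =>
    hk _ _ (surjInv_eq (hsurj k) (C (x, k))).symm
  refine ⟨f, fun j => ?_, fun ω => ⟨⟨⟨fun v => (⟨some ω, v⟩, k), fun _ _ h =>
    sigma_mk_injective (β := V') (i := some ω) (congrArg Prod.fst h)⟩, fun {a b} => ?_⟩, fun v => hf ⟨some ω, v⟩⟩⟩
  · obtain ⟨x, hx⟩ := hU.surjective hS hleS hUtight.strict j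
    exact ⟨_, (hf x).symm.trans hx⟩
  · exact (hH.same _ _ k).trans (disjUnion_adj G' (some ω) a b)

/-- There are finitely many maps `f`. If each had a counterexample, colouring a universal graph for
all of them would single out one `f` and colour its counterexample correctly. -/
theorem exists_factor_map {P : GraphProperty} (hP : P.IsFactor) {m : ℕ}
    {R : Fin m → GraphProperty} (hR : ∀ i, (R i).IsFactor) (hRP : P = prod R)
    {Q : Fin P.dec → GraphProperty} (hQ : ∀ i, (Q i).IsFactor) (hQP : P = prod Q) :
    ∃ f : Fin P.dec → Fin m, ∀ (j : Fin m) (V : Type) (_ : Finite V) (G : SimpleGraph V),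
      (R j).Holds G → ∃ c : V → Fin P.dec, HasFibres Q G c ∧ ∀ v, f (c v) = j := by
  by_contra! hne
  choose j V hV G hG hbad using hne
  obtain ⟨W, _, H, hH, hHC⟩ := exists_universal hP hR hRP hQ hQP G (fun f _ => j f)
    fun f => (hasFibres_const_iff hR).2 (hG f)
  obtain ⟨C, hC⟩ : ∃ C : W → Fin P.dec, HasFibres Q H C := by
    rw [hQP] at hH
    exact hH
  obtain ⟨f, -, hf⟩ := hHC C hC
  obtain ⟨e, he⟩ := hf f
  obtain ⟨v, hv⟩ := hbad f (C ∘ e)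
    (hC.restrict hQ e e.injective fun x y => (e.map_adj_iff (v := x) (w := y)).symm)
  exact hv (he v).symm

/-- Provides the converse to `hf`. A universal graph for one counterexample per permutation is
coloured by `R`, and each class is refined by `hf` to a `Q`-colouring; the surjection this yields on
the `P.dec` colours is a permutation, and its inverse has no counterexample. -/
theorem exists_factor_perm {P : GraphProperty} (hP : P.IsFactor) {m : ℕ}
    {R : Fin m → GraphProperty} (hR : ∀ i, (R i).IsFactor) (hRP : P = prod R)
    {Q : Fin P.dec → GraphProperty} (hQ : ∀ i, (Q i).IsFactor) (hQP : P = prod Q)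
    {f : Fin P.dec → Fin m}
    (hf : ∀ (j : Fin m) (V : Type) (_ : Finite V) (G : SimpleGraph V), (R j).Holds G →
      ∃ c : V → Fin P.dec, HasFibres Q G c ∧ ∀ v, f (c v) = j) :
    ∃ π : Equiv.Perm (Fin P.dec), ∀ (V : Type) (_ : Finite V) (G : SimpleGraph V)
      (d : V → Fin P.dec), HasFibres Q G d →
        HasFibres (Q ∘ π) G d ∧ HasFibres R G fun v => f (π (d v)) := by
  by_contra! hne
  choose V hV G d hd hbad using hne
  obtain ⟨W, _, H, hH, hHC⟩ := exists_universal hP hQ hQP hQ hQP G d hd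
  obtain ⟨D, hD⟩ : ∃ D : W → Fin m, HasFibres R H D := by
    rw [hRP] at hH
    exact hH
  choose C hC hfC using fun j => hf j _ inferInstance _ (hD j)
  let C' : W → Fin P.dec := fun x => C (D x) ⟨x, rfl⟩
  have hCC : ∀ j (x : ↥(D ⁻¹' {j})), C' x.1 = C j x := by
    rintro j ⟨x, hx⟩
    cases hx
    rfl
  have hfC' : ∀ x, f (C' x) = D x := fun x => hfC _ _
  have hC' : HasFibres Q H C' := by
    intro a
    have hx : ∀ x : ↥(C' ⁻¹' {a}), D x.1 = f a := fun x => by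
      rw [← hfC' x.1, show C' x.1 = a from x.2]
    have hmem : ∀ x : ↥(C' ⁻¹' {a}), C (f a) ⟨x.1, hx x⟩ = a := fun x =>
      (hCC (f a) ⟨x.1, hx x⟩).symm.trans x.2
    refine (hQ a).of_injective (fun x => ⟨⟨x.1, hx x⟩, hmem x⟩) (fun x y hxy => ?_)
      (fun _ _ => Iff.rfl) (hC (f a) a)
    exact Subtype.ext (congrArg (fun z => z.1.1) hxy)
  obtain ⟨σ, hσ, he⟩ := hHC C' hC'
  let s : Equiv.Perm (Fin P.dec) := Equiv.ofBijective σ (Finite.surjective_iff_bijective.1 hσ)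
  obtain ⟨e, he⟩ := he s.symm
  have he' : s.symm ∘ d s.symm = C' ∘ e := by
    funext v
    exact s.symm_apply_eq.2 (he v)
  have hadj : ∀ x y, (G s.symm).Adj x y ↔ H.Adj (e x) (e y) := fun x y =>
    (e.map_adj_iff (v := x) (w := y)).symm
  refine hbad s.symm ?_ ?_
  · refine (hasFibres_comp_iff hQ s.symm.injective).1 ?_
    rw [he']
    exact hC'.restrict hQ e e.injective hadj
  · have : (fun v => f (s.symm (d s.symm v))) = D ∘ e := by
      funext v
      rw [← comp_apply (f := s.symm), he']
      exact hfC' _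
    rw [this]
    exact hD.restrict hR e e.injective hadj

theorem factorisation_unique {P : GraphProperty} (hP : P.IsFactor) {m : ℕ}
    {R : Fin m → GraphProperty} (hR : ∀ i, (R i).IsFactor) (hRirr : ∀ i, (R i).IsIrreducible)
    (hRP : P = prod R)
    {Q : Fin P.dec → GraphProperty} (hQ : ∀ i, (Q i).IsFactor) (hQP : P = prod Q) :
    ∃ e : Fin m ≃ Fin P.dec, ∀ i, R i = Q (e i) := by
  obtain ⟨f, hf⟩ := exists_factor_map hP hR hRP hQ hQP
  obtain ⟨π, hπ⟩ := exists_factor_perm hP hR hRP hQ hQP hf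
  -- `π` only enlarges factors, and some power of it is its inverse, so factors in one orbit
  -- coincide and `π` can be undone.
  have hle : ∀ (k : ℕ) (a : Fin P.dec) {V : Type} [Finite V] (G : SimpleGraph V), (Q a).Holds G →
      (Q ((π ^ k) a)).Holds G := by
    intro k
    induction k with
    | zero => exact fun a V _ G h => h
    | succ k ih =>
      intro a V _ G h
      have h1 := (hπ V _ G _ ((hasFibres_const_iff hQ).2 (ih a G h))).1
      rw [pow_succ', Equiv.Perm.mul_apply]
      exact (hasFibres_const_iff fun i => hQ (π i)).1 h1
  have hfib : ∀ {V : Type} [Finite V] (G : SimpleGraph V) (c : V → Fin P.dec), HasFibres Q G c →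
      HasFibres Q G (π.symm ∘ c) := by
    intro V _ G c h
    refine (hasFibres_comp_iff hQ π.symm.injective).2 fun i => ?_
    have h1 := hle (orderOf π - 1) i _ (h i)
    have h2 : π ^ (orderOf π - 1) = π.symm := by
      rw [← Equiv.Perm.inv_def, pow_sub _ (orderOf_pos π), pow_orderOf_eq_one]
      simp
    rwa [h2] at h1
  have hback : ∀ (j : Fin m) {V : Type} [Finite V] (G : SimpleGraph V) (c : V → Fin P.dec),
      HasFibres Q G c → (∀ v, f (c v) = j) → (R j).Holds G := by
    intro j V _ G c h hc
    have h1 := (hπ V _ G _ (hfib G c h)).2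
    simp only [comp_apply, Equiv.apply_symm_apply, hc] at h1
    exact (hasFibres_const_iff hR).1 h1
  have hinj : Injective f := by
    intro a b hab
    by_contra hne
    let g := Finite.equivFin {x // f x = f a}
    have hg : Injective fun i => (g.symm i).1 := Subtype.val_injective.comp g.symm.injective
    -- `R (f a)` is the product of the `Q` over the fibre of `f a`, which has at least the two
    -- members `a` and `b`.
    refine hRirr (f a) ⟨_, fun i => Q (g.symm i), ?_,
      fun i => ⟨(hQ _).nontrivial, (hQ _).additive, (hQ _).hereditary⟩, ?_⟩
    · have : Nontrivial {x // f x = f a} :=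
        ⟨⟨a, rfl⟩, ⟨b, hab.symm⟩, fun h => hne (congrArg Subtype.val h)⟩
      exact Finite.one_lt_card
    · refine GraphProperty.ext ?_
      funext V _ G
      refine propext ⟨fun h => ?_, ?_⟩
      · obtain ⟨c, hc, hfc⟩ := hf _ V _ G h
        refine ⟨fun v => g ⟨c v, hfc v⟩, (hasFibres_comp_iff hQ hg).1 ?_⟩
        convert hc using 1
        funext v
        simp
      · rintro ⟨c, hc⟩
        exact hback _ G _ ((hasFibres_comp_iff hQ hg (c := c)).2 hc) fun v => (g.symm (c v)).2
  have hsurj : Surjective f := by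
    intro j
    obtain ⟨V, _, ⟨v⟩, G, hG⟩ := (hR j).nontrivial.1
    obtain ⟨c, -, hc⟩ := hf j V _ G hG
    exact ⟨_, hc v⟩
  have hbij : Bijective f := ⟨hinj, hsurj⟩
  refine ⟨(Equiv.ofBijective f hbij).symm, fun i => ?_⟩
  obtain ⟨a, rfl⟩ := hsurj i
  rw [Equiv.ofBijective_symm_apply_apply]
  refine GraphProperty.ext ?_
  funext V _ G
  refine propext ⟨fun h => ?_, fun h => ?_⟩
  · obtain ⟨c, hc, hfc⟩ := hf _ V _ G h
    obtain rfl : c = fun _ => a := funext fun v => hinj (hfc v)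
    exact (hasFibres_const_iff hQ).1 hc
  · exact hback _ G _ ((hasFibres_const_iff hQ).2 h) fun _ => rfl

/-! ### Existence: an ideal of tight coloured graphs -/

/-- The coloured graph `H` is a blowup of the coloured graph `G`. -/
def IsBelow {V W ι : Type} (G : SimpleGraph V) (c : V → ι) (H : SimpleGraph W) (C : W → ι) : Prop :=
  ∃ (K : Type) (_ : Finite K) (φ : W → V) (κ : W → K), IsBlowup G c H φ κ ∧ c ∘ φ = C

theorem IsBelow.of_injective {V W ι : Type} {G : SimpleGraph V} {H : SimpleGraph W} (c : V → ι)
    (f : W → V) (hf : Injective f) (h : ∀ x y, H.Adj x y ↔ G.Adj (f x) (f y)) :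
    IsBelow G c H (c ∘ f) :=
  ⟨Unit, inferInstance, f, _, IsBlowup.of_injective c f hf fun x y _ => h x y, rfl⟩

theorem IsBelow.trans {U V W ι : Type} {F : SimpleGraph U} {b : U → ι} {G : SimpleGraph V}
    {c : V → ι} {H : SimpleGraph W} {d : W → ι} (h : IsBelow F b G c) (h' : IsBelow G c H d) :
    IsBelow F b H d := by
  obtain ⟨K, _, φ, κ, h, rfl⟩ := h
  obtain ⟨L, _, ψ, μ, h', rfl⟩ := h'
  exact ⟨_, inferInstance, _, _, h.trans h', rfl⟩

theorem IsGood.of_isBelow {P : GraphProperty} {V W ι : Type} [Finite W] {G : SimpleGraph V}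
    {c : V → ι} {H : SimpleGraph W} {C : W → ι} (hc : P.IsGood G c) (h : IsBelow G c H C) :
    P.Holds H := by
  obtain ⟨K, _, φ, κ, h, -⟩ := h
  exact hc h

theorem IsBelow.sum {V W W' ι : Type} {G : SimpleGraph V} {c : V → ι} {H : SimpleGraph W}
    {C : W → ι} {H' : SimpleGraph W'} {C' : W' → ι} (h : IsBelow G c H C)
    (h' : IsBelow G c H' C') : IsBelow G c (H.sum H') (Sum.elim C C') := by
  obtain ⟨K, _, φ, κ, h, rfl⟩ := h
  obtain ⟨L, _, ψ, μ, h', rfl⟩ := h'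
  refine ⟨K ⊕ L, inferInstance, Sum.elim φ ψ, Sum.map κ μ, ⟨?_, ?_⟩, ?_⟩
  · rintro (x | x) (y | y) h1 h2
    · exact congrArg _ (h.inj _ _ h1 (by simpa using h2))
    · simp at h2
    · simp at h2
    · exact congrArg _ (h'.inj _ _ h1 (by simpa using h2))
  · rintro (x | x) (y | y) h1
    · simpa using h.adj x y h1
    · simp
    · simp
    · simpa using h'.adj x y h1
  · exact Sum.comp_elim c φ ψ

/-- A blowup constrains only edges within a colour, so the classes can be treated separately, with
the disjoint union of their sets of copies as the new index set. -/
theorem IsBelow.of_fibres {V W ι : Type} [Finite ι] {G : SimpleGraph V} {c : V → ι}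
    {H : SimpleGraph W} {C : W → ι}
    (h : ∀ i, IsBelow G c (H.induce (C ⁻¹' {i})) fun _ => i) : IsBelow G c H C := by
  choose K hK φ κ h hc using h
  have hφ : ∀ i w (hw : C w = i), φ (C w) ⟨w, rfl⟩ = φ i ⟨w, hw⟩ := by
    rintro i w rfl
    rfl
  have hκ : ∀ i w (hw : C w = i),
      (⟨C w, κ (C w) ⟨w, rfl⟩⟩ : Σ i, K i) = ⟨i, κ i ⟨w, hw⟩⟩ := by
    rintro i w rfl
    rfl
  have hcol : ∀ w, c (φ (C w) ⟨w, rfl⟩) = C w := fun w => congrFun (hc (C w)) ⟨w, rfl⟩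
  refine ⟨Σ i, K i, inferInstance, fun w => φ (C w) ⟨w, rfl⟩, fun w => ⟨C w, κ (C w) ⟨w, rfl⟩⟩,
    ⟨fun x y h1 h2 => ?_, fun x y h1 => ?_⟩, funext hcol⟩
  · have hxy : C y = C x := (congrArg Sigma.fst h2).symm
    rw [hφ _ y hxy] at h1
    rw [hκ _ y hxy] at h2
    exact congrArg Subtype.val ((h (C x)).inj _ _ h1 (by simpa using h2))
  · rw [hcol, hcol] at h1
    have := (h (C x)).adj ⟨x, rfl⟩ ⟨y, h1.symm⟩
      ((congrFun (hc (C x)) ⟨x, rfl⟩).trans (congrFun (hc (C x)) ⟨y, h1.symm⟩).symm)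
    rw [hκ _ y h1.symm, hφ _ y h1.symm]
    simpa using this

/-- A tight graph with a good colouring that uses all of the `n` colours. -/
structure TightColoured (P : GraphProperty) (n : ℕ) where
  V : Type
  finite : Finite V
  G : SimpleGraph V
  c : V → Fin n
  tight : P.IsTight n G
  good : P.IsGood G c
  surjective : Surjective c

instance (P : GraphProperty) (n : ℕ) : Preorder (TightColoured P n) where
  le A B := IsBelow B.G B.c A.G A.c
  le_refl A := IsBelow.of_injective A.c id injective_id fun _ _ => Iff.rfl
  le_trans _ _ _ h h' := h'.trans h

theorem TightColoured.le_def {P : GraphProperty} {n : ℕ} {A B : TightColoured P n} :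
    A ≤ B ↔ IsBelow B.G B.c A.G A.c :=
  Iff.rfl

/-- Every graph with property `P` and every tight coloured graph lie below a common tight coloured
graph. -/
theorem TightColoured.exists_ge {P : GraphProperty} (hP : P.IsFactor) {W : Type} [Finite W]
    {Y : SimpleGraph W} (hY : P.Holds Y) (B : TightColoured P P.dec) :
    ∃ A : TightColoured P P.dec, (∃ c, IsBelow A.G A.c Y c) ∧ B ≤ A := by
  have := B.finite
  obtain ⟨K, _, H, hH, hHC⟩ := B.tight.exists_isLayered_refining B.c
  have hHP : P.Holds H := B.good hH.isBlowup
  -- The colouring of `B` itself is used only to get a layer at all.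
  obtain ⟨k₀, -⟩ := hHC (B.c ∘ Prod.fst) (B.good.blowup hH.isBlowup) fun k => B.surjective
  have hadj : ∀ k x y, B.G.Adj x y ↔ (H.sum Y).Adj (Sum.inl (x, k)) (Sum.inl (y, k)) :=
    fun k x y => by simp [hH.same]
  have hinj : ∀ k, Injective fun x : B.V => (Sum.inl (x, k) : (B.V × K) ⊕ W) :=
    fun k x y h => by simpa using h
  have htight : P.IsTight P.dec (H.sum Y) :=
    B.tight.mono hP.hereditary (hP.additive _ _ hHP hY) _ (hinj k₀) (hadj k₀)
  obtain ⟨C, hCs, hC⟩ := htight.strict.exists_isGood hP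
  have hs : ∀ k, Surjective fun v => C (Sum.inl (v, k)) := by
    intro k i
    obtain ⟨w, rfl⟩ := hCs i
    exact hC.surjective_restrict B.tight.strict _ (hinj k) (hadj k) w
  obtain ⟨k, hk⟩ := hHC (C ∘ Sum.inl)
    (hC.restrict _ Sum.inl_injective fun x y => by simp) hs
  -- On layer `k` the colouring `C` refines that of `B`, so `g` renames colours until this layer is
  -- a coloured copy of `B`.
  let g : Fin P.dec → Fin P.dec := fun i => B.c (surjInv (hs k) i)
  have hg : ∀ v, g (C (Sum.inl (v, k))) = B.c v := fun v =>
    hk _ _ (surjInv_eq (hs k) (C (Sum.inl (v, k))))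
  refine ⟨⟨_, inferInstance, H.sum Y, g ∘ C, htight, hC.coarsen fun x y h => congrArg g h,
    fun i => ?_⟩, ⟨_, IsBelow.of_injective _ Sum.inr Sum.inr_injective fun x y => by simp⟩, ?_⟩
  · obtain ⟨v, rfl⟩ := B.surjective i
    exact ⟨_, hg v⟩
  · rw [TightColoured.le_def]
    have := IsBelow.of_injective (g ∘ C) _ (hinj k) (hadj k)
    convert this using 1
    funext v
    exact (hg v).symm

/-- The Rasiowa–Sikorski argument: graphs on the sets `Fin N` are countable in number, and
`TightColoured.exists_ge` makes the requirement of each one cofinal. -/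
theorem IsFactor.exists_ideal {P : GraphProperty} (hP : P.IsFactor) :
    ∃ I : Order.Ideal (TightColoured P P.dec), ∀ (V : Type) (_ : Finite V) (Y : SimpleGraph V),
      P.Holds Y → ∃ A ∈ I, ∃ c, IsBelow A.G A.c Y c := by
  let X := {p : Σ N : ℕ, SimpleGraph (Fin N) // P.Holds p.2}
  have : Encodable X := Encodable.ofCountable X
  let D : X → Order.Cofinal (TightColoured P P.dec) := fun p =>
    ⟨{A | ∃ c, IsBelow A.G A.c p.1.2 c}, fun B => TightColoured.exists_ge hP p.2 B⟩
  obtain ⟨V₀, _, G₀, hG₀⟩ := hP.exists_isTight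
  obtain ⟨c₀, hs, hc₀⟩ := hG₀.strict.exists_isGood hP
  refine ⟨Order.idealOfCofinals ⟨V₀, _, G₀, c₀, hG₀, hc₀, hs⟩ D, fun V _ Y hY => ?_⟩
  have e := Finite.equivFin V
  obtain ⟨A, ⟨c, hc⟩, hA⟩ := Order.cofinal_meets_idealOfCofinals ⟨V₀, _, G₀, c₀, hG₀, hc₀, hs⟩ D
    ⟨⟨_, Y.comap e.symm⟩, hP.of_injective e.symm e.symm.injective (fun _ _ => Iff.rfl) hY⟩
  exact ⟨A, hA, c ∘ e, hc.trans (IsBelow.of_injective c e e.injective fun x y => by simp)⟩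

/-- The graphs that lie below the `a`-coloured parts of the members of `I`. -/
def idealFactor {P : GraphProperty} {n : ℕ} (I : Order.Ideal (TightColoured P n)) (a : Fin n) :
    GraphProperty where
  Holds Z := ∃ A ∈ I, IsBelow A.G A.c Z fun _ => a
  iso_closed := by
    rintro V W _ _ G H e ⟨A, hA, h⟩
    exact ⟨A, hA, h.trans (IsBelow.of_injective _ e.symm e.symm.injective fun x y =>
      (e.symm.map_adj_iff).symm)⟩

theorem idealFactor_isFactor {P : GraphProperty} (hP : P.IsFactor) {n : ℕ}
    (I : Order.Ideal (TightColoured P n)) (a : Fin n) : (idealFactor I a).IsFactor := by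
  refine ⟨⟨?_, ?_⟩, ?_, ?_⟩
  · obtain ⟨A, hA⟩ := I.nonempty
    obtain ⟨v, rfl⟩ := A.surjective a
    exact ⟨Unit, inferInstance, inferInstance, ⊥, A, hA,
      IsBelow.of_injective A.c (fun _ => v) (fun _ _ _ => rfl) fun _ _ => by simp⟩
  · obtain ⟨V, _, F, hF⟩ := hP.nontrivial.2
    refine ⟨V, inferInstance, F, ?_⟩
    rintro ⟨A, -, h⟩
    exact hF (A.good.of_isBelow h)
  · rintro V W _ _ G H ⟨A, hA, h⟩ ⟨B, hB, h'⟩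
    obtain ⟨C, hC, hAC, hBC⟩ := I.directed A hA B hB
    refine ⟨C, hC, ?_⟩
    have := (IsBelow.trans hAC h).sum (IsBelow.trans hBC h')
    rwa [Sum.elim_lam_const_lam_const] at this
  · rintro V W _ _ G H ⟨e⟩ ⟨A, hA, h⟩
    exact ⟨A, hA, h.trans (IsBelow.of_injective _ e e.injective fun x y =>
      (e.map_adj_iff).symm)⟩

/-- A graph of `P` inherits its partition from a member of the ideal above it. Conversely, the
members witnessing the classes of a product have a common upper bound `B`; the classes glue to one
blowup of `B`, whose colouring is good. -/
theorem IsFactor.exists_factorisation {P : GraphProperty} (hP : P.IsFactor) :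
    ∃ Q : Fin P.dec → GraphProperty, (∀ a, (Q a).IsFactor) ∧ P = prod Q := by
  obtain ⟨I, hI⟩ := hP.exists_ideal
  refine ⟨idealFactor I, idealFactor_isFactor hP I, GraphProperty.ext ?_⟩
  funext V _ Y
  refine propext ⟨fun h => ?_, ?_⟩
  · obtain ⟨A, hA, c, hc⟩ := hI V _ Y h
    refine ⟨c, fun a => ⟨A, hA, ?_⟩⟩
    have := hc.trans (IsBelow.of_injective (H := Y.induce (c ⁻¹' {a})) c Subtype.val
      Subtype.val_injective fun _ _ => Iff.rfl)
    convert this using 1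
    funext x
    exact x.2.symm
  · rintro ⟨c, hc⟩
    choose A hA h using hc
    have : Nonempty {x // x ∈ (I : Set (TightColoured P P.dec))} := I.nonempty.to_subtype
    obtain ⟨B, hB, hAB⟩ : ∃ B ∈ I, ∀ a, A a ≤ B := by
      have := I.directed.directed_val.finite_le fun a => (⟨A a, hA a⟩ : {x // x ∈ (I : Set _)})
      obtain ⟨B, hB⟩ := this
      exact ⟨B.1, B.2, hB⟩
    exact B.good.of_isBelow (IsBelow.of_fibres fun a => IsBelow.trans (hAB a) (h a))

/-! ### Irreducibility of the factors -/

/-- A factor of a factorisation with `P.dec` factors is irreducible. -/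
theorem isIrreducible_of_eq_prod {P : GraphProperty} (hP : P.IsFactor)
    {Q : Fin P.dec → GraphProperty} (hQ : ∀ a, (Q a).IsFactor) (hQP : P = prod Q) (a : Fin P.dec) :
    (Q a).IsIrreducible := by
  classical
  rintro ⟨N, Q', hN, hQ', hprod⟩
  let S : {b // b ≠ a} ⊕ Fin N → GraphProperty := Sum.elim (fun b => Q b) Q'
  have hS : ∀ i, (S i).IsFactor := by
    rintro (b | j)
    · exact hQ b
    · exact ⟨(hQ' j).1, (hQ' j).2.1, (hQ' j).2.2⟩
  have hSP : ProdLE S P := by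
    intro V _ G c hc
    rw [hQP]
    refine ⟨Sum.elim Subtype.val (fun _ => a) ∘ c, fun b => ?_⟩
    by_cases hb : b = a
    · subst hb
      rw [hprod]
      have hx : ∀ x : ↥(Sum.elim Subtype.val (fun _ => b) ∘ c ⁻¹' {b}), ∃ j, c x.1 = Sum.inr j := by
        rintro ⟨x, hx⟩
        rcases hcx : c x with i | j
        · simp only [Set.mem_preimage, comp_apply, hcx, Sum.elim_inl, Set.mem_singleton_iff] at hx
          exact absurd hx i.2
        · exact ⟨j, rfl⟩
      choose d hd using hx
      refine ⟨d, fun j => (hS (Sum.inr j)).of_injective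
        (fun x => ⟨x.1.1, (hd x.1).trans (congrArg _ x.2)⟩) (fun x y hxy => ?_)
        (fun _ _ => Iff.rfl) (hc (Sum.inr j))⟩
      exact Subtype.ext (Subtype.ext (congrArg Subtype.val hxy :))
    · have hx : ∀ x : ↥(Sum.elim Subtype.val (fun _ => a) ∘ c ⁻¹' {b}),
          c x.1 = Sum.inl ⟨b, hb⟩ := by
        rintro ⟨x, hx⟩
        rcases hcx : c x with i | j
        · simp only [Set.mem_preimage, comp_apply, hcx, Sum.elim_inl, Set.mem_singleton_iff] at hx
          simp [← hx]
        · simp only [Set.mem_preimage, comp_apply, hcx, Sum.elim_inr, Set.mem_singleton_iff] at hx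
          exact absurd hx.symm hb
      refine (hS (Sum.inl ⟨b, hb⟩)).of_injective (fun x => ⟨x.1, hx x⟩) (fun x y hxy => ?_)
        (fun _ _ => Iff.rfl) (hc (Sum.inl ⟨b, hb⟩))
      exact Subtype.ext (congrArg Subtype.val hxy :)
  obtain ⟨V, _, G, hG⟩ := hP.exists_isTight
  obtain ⟨c, hc⟩ : ∃ c : V → Fin P.dec, HasFibres Q G c := by
    have := hG.strict.1
    rw [hQP] at this
    exact this
  obtain ⟨d, hd⟩ : ∃ d, HasFibres Q' (G.induce (c ⁻¹' {a})) d := by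
    have := hc a
    rw [hprod] at this
    exact this
  let C : V → {b // b ≠ a} ⊕ Fin N := fun x =>
    if h : c x = a then Sum.inr (d ⟨x, h⟩) else Sum.inl ⟨c x, h⟩
  have hC : HasFibres S G C := by
    rintro (b | j)
    · have hx : ∀ x : ↥(C ⁻¹' {Sum.inl b}), c x.1 = b := by
        rintro ⟨x, hx⟩
        by_cases h : c x = a
        · simp [C, h] at hx
        · simp only [C, h, Set.mem_preimage, dite_false, Set.mem_singleton_iff,
            Sum.inl.injEq] at hx
          simp [← hx]
      refine (hQ b).of_injective (fun x => ⟨x.1, hx x⟩) (fun x y hxy => ?_) (fun _ _ => Iff.rfl)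
        (hc b)
      exact Subtype.ext (congrArg Subtype.val hxy :)
    · have hx : ∀ x : ↥(C ⁻¹' {Sum.inr j}), ∃ h : c x.1 = a, d ⟨x.1, h⟩ = j := by
        rintro ⟨x, hx⟩
        by_cases h : c x = a
        · exact ⟨h, by simpa [C, h] using hx⟩
        · simp [C, h] at hx
      refine (hS (Sum.inr j)).of_injective (fun x => ⟨⟨x.1, (hx x).1⟩, (hx x).2⟩)
        (fun x y hxy => ?_) (fun _ _ => Iff.rfl) (hd j)
      exact Subtype.ext (congrArg (fun z => z.1.1) hxy)
  -- Replacing `Q a` by `N ≥ 2` factors gives a good colouring of a tight graph with `P.dec - 1 + N`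
  -- colours, more than `P.dec`.
  have := hG.card_le (hC.isGood hS hSP) (hC.surjective hS hSP hG.strict)
  rw [Nat.card_sum, Nat.card_eq_fintype_card, Fintype.card_subtype_compl] at this
  simp only [Fintype.card_fin, Fintype.card_subtype_eq, Nat.card_eq_fintype_card] at this
  omega

end GraphProperty

theorem mainTheorem1 (P : GraphProperty) (hP : P.IsNontrivial) (hadd : P.IsAdditive)
    (hher : P.IsInducedHereditary) :
    ∃ Q : Fin P.dec → GraphProperty, P.IsIrredFactorisation Q ∧
      ∀ (m : ℕ) (R : Fin m → GraphProperty), P.IsIrredFactorisation R →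
        m = P.dec ∧ ∃ e : Fin m ≃ Fin P.dec, ∀ i, R i = Q (e i) := by
  have hP : P.IsFactor := ⟨hP, hadd, hher⟩
  obtain ⟨Q, hQ, hQP⟩ := hP.exists_factorisation
  refine ⟨Q, ⟨fun i => ⟨(hQ i).nontrivial, (hQ i).additive, (hQ i).hereditary,
    GraphProperty.isIrreducible_of_eq_prod hP hQ hQP i⟩, hQP⟩, fun m R hR => ?_⟩
  obtain ⟨e, he⟩ := GraphProperty.factorisation_unique hP
    (fun i => ⟨(hR.1 i).1, (hR.1 i).2.1, (hR.1 i).2.2.1⟩) (fun i => (hR.1 i).2.2.2) hR.2 hQ hQP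
  exact ⟨by simpa using Fintype.card_congr e, e, he⟩
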